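/- Let $\nu$ be a probability measure on $\mathbb{R}^d$ with bounded support, i.e. $|\xi|\le R$ for $\nu$-almost every $\xi$, for some constant $R$. Let $\mathbb{S}^{d-1}\subset\mathbb{R}^d$ be the unit sphere with its surface measure $dS$, and write $\mathbb{Q}v=v/|v|$ for $v\ne 0$. For a step size $\eta\ge 0$ consider the Markov chain $w^{n+1}=\mathbb{Q}(w^n+\eta\,\xi_{n+1}\xi_{n+1}^Tw^n)$ on $\mathbb{S}^{d-1}$ with $\xi_1,\xi_2,\dots$ independent with law $\nu$ (online PCA). For a function $u$ on $\mathbb{S}^{d-1}$ put $$Su(w)=\mathbb{E}_{\xi\sim\nu}\,u\big(\mathbb{Q}(w+\eta\,\xi\xi^Tw)\big),\qquad w\in\mathbb{S}^{d-1},$$ and for a test function $\varphi$ put $u^n(w)=\mathbb{E}\big[\varphi(w^n)\,\big|\,w^0=w\big]$. For $\psi:\mathbb{S}^{d-1}\to\mathbb{R}$, extended to $\mathbb{R}^d\setminus\{0\}$ by $\psi(x/|x|)$, let $\nabla_S\psi(w)=(I-w\otimes w)\nabla\psi(w)$, a vector with components $\nabla_S^{1}\psi,\dots,\nabla_S^{d}\psi$.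 Write $\psi\in C^k(\mathbb{S}^{d-1})$ if $\psi$ is $k$ times continuously differentiable, and let $$\|\psi\|_{C^k(\mathbb{S}^{d-1})}=\sum_{m=0}^{k}\ \sum_{\alpha\in\{1,\dots,d\}^m}\ \sup_{w\in\mathbb{S}^{d-1}}\big|\nabla_S^{\alpha_1}\cdots\nabla_S^{\alpha_m}\psi(w)\big|.$$ Then: (i) For every $\eta\ge 0$, the formula for $S$ defines (independently of the chosen representative, up to $dS$-null sets) a bounded linear operator $S:L^\infty(\mathbb{S}^{d-1})\to L^\infty(\mathbb{S}^{d-1})$ which is a contraction: $\|Su\|_{L^\infty}\le\|u\|_{L^\infty}$. (ii) For every $k\in\mathbb{N}=\{0,1,2,\dots\}$ there is $\eta_0>0$ such that for every $T\ge 0$ there is a constant $C=C(k,\eta_0,T)$ with the following property. For every $\varphi\in C^k(\mathbb{S}^{d-1})$, every $0\le\eta\le\eta_0$ and every $n\ge 0$ with $n\eta\le T$, one has $u^n=S^n\varphi\in C^k(\mathbb{S}^{d-1})$ and $$\|u^n\|_{C^k(\mathbb{S}^{d-1})}\le C\,\|\varphi\|_{C^k(\mathbb{S}^{d-1})}.$$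 (iii) For every $\eta\ge 0$ there is a bounded linear operator $S^*:L^1(\mathbb{S}^{d-1})\to L^1(\mathbb{S}^{d-1})$ of which $S$ is the dual, that is, $$\int_{\mathbb{S}^{d-1}}(Su)\,\rho\,dS=\int_{\mathbb{S}^{d-1}}u\,(S^*\rho)\,dS\qquad\text{for all }u\in L^\infty(\mathbb{S}^{d-1}),\ \rho\in L^1(\mathbb{S}^{d-1}).$$ It is a contraction, $\|S^*\rho\|_{1}\le\|\rho\|_{1}$ for all $\rho\in L^1(\mathbb{S}^{d-1})$, and if $\rho\ge 0$ then $S^*\rho\ge 0$ and $\|S^*\rho\|_1=\|\rho\|_1$. -/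

import Mathlib

open MeasureTheory
open scoped NNReal ENNReal

noncomputable section

namespace Oja

/-- Euclidean space `ℝ^d`. -/
abbrev E (d : ℕ) : Type := EuclideanSpace ℝ (Fin d)

/-- The unit sphere `S^{d-1}` of `ℝ^d`. -/
abbrev Sph (d : ℕ) : Type := Metric.sphere (0 : E d) 1

/-- The surface measure of `S^{d-1}`. -/
abbrev surf (d : ℕ) : Measure (Sph d) := (volume : Measure (E d)).toSphere

variable {d : ℕ}

/-- The normalization `Q v = v / |v|` of a nonzero vector. -/
def Q (v : E d) (hv : v ≠ 0) : Sph d :=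
  ⟨‖v‖⁻¹ • v, by
    rw [mem_sphere_zero_iff_norm, norm_smul, norm_inv, norm_norm]
    exact inv_mul_cancel₀ (norm_ne_zero_iff.mpr hv)⟩

theorem ne_zero_of_sphere (η : ℝ≥0) (ξ : E d) (w : Sph d) :
    (w : E d) + ((η : ℝ) * inner ℝ ξ (w : E d)) • ξ ≠ 0 := by
  intro h
  have h1 : inner ℝ ((w : E d) + ((η : ℝ) * inner ℝ ξ (w : E d)) • ξ) (w : E d) = 0 := by
    rw [h, inner_zero_left]
  have hw : ‖(w : E d)‖ = 1 := mem_sphere_zero_iff_norm.mp w.2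
  rw [inner_add_left, real_inner_self_eq_norm_sq, hw, real_inner_smul_left] at h1
  have h2 : 0 ≤ (η : ℝ) * (inner ℝ ξ (w : E d) * inner ℝ ξ (w : E d)) :=
    mul_nonneg η.2 (mul_self_nonneg _)
  nlinarith

/-- One step of the algorithm: `w ↦ Q (w + η ξ ξᵀ w)`. -/
def step (η : ℝ≥0) (ξ : E d) (w : Sph d) : Sph d :=
  Q ((w : E d) + ((η : ℝ) * inner ℝ ξ (w : E d)) • ξ) (ne_zero_of_sphere η ξ w)

/-- The operator `(S u)(w) = 𝔼 u(Q (w + η ξ ξᵀ w))`, `ξ ∼ ν`. -/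
def op (ν : Measure (E d)) (η : ℝ≥0) (u : Sph d → ℝ) : Sph d → ℝ :=
  fun w => ∫ ξ, u (step η ξ w) ∂ν

/-- The state `wⁿ` of the chain started at `w` and driven by the samples `ξ 0, …, ξ (n-1)`. -/
def chain (η : ℝ≥0) : (n : ℕ) → (Fin n → E d) → Sph d → Sph d
  | 0, _, w => w
  | n + 1, ξ, w => step η (ξ (Fin.last n)) (chain η n (fun i => ξ i.castSucc) w)

/-- `uⁿ(w) = 𝔼_w φ(wⁿ)`, the samples being independent with common law `ν`. -/
def mean (ν : Measure (E d)) (η : ℝ≥0) (φ : Sph d → ℝ) (n : ℕ) : Sph d → ℝ :=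
  fun w => ∫ ξ, φ (chain η n ξ w) ∂(Measure.pi fun _ : Fin n => ν)

open Classical in
/-- The extension `x ↦ ψ (x / |x|)` of a function on the sphere to `ℝ^d ∖ {0}`
(with the value `0` at the origin, which plays no role). -/
def ext (ψ : Sph d → ℝ) : E d → ℝ :=
  fun x => if hx : x ≠ 0 then ψ (Q x hx) else 0

/-- `ψ ∈ C^k(S^{d-1})`. -/
def IsCk (k : ℕ) (ψ : Sph d → ℝ) : Prop :=
  ContDiffOn ℝ k (ext ψ) {0}ᶜ

/-- The `i`-th component of the spherical gradient `∇_S ψ = (I - w ⊗ w) ∇ψ`: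
as `I - w ⊗ w` is symmetric, it is the derivative of the extension of `ψ` along
`(I - w ⊗ w) e_i = e_i - w_i w`. -/
def grad (i : Fin d) (ψ : Sph d → ℝ) : Sph d → ℝ :=
  fun w => fderiv ℝ (ext ψ) (w : E d)
    (EuclideanSpace.single i (1 : ℝ) - ((w : E d) i) • (w : E d))

/-- The iterated spherical derivative `∇_S^α ψ = ∇_S^{α_1} ⋯ ∇_S^{α_m} ψ`. -/
def iterGrad : (m : ℕ) → (Fin m → Fin d) → (Sph d → ℝ) → Sph d → ℝ
  | 0, _, ψ => ψ
  | m + 1, α, ψ => grad (α 0) (iterGrad m (fun j => α j.succ) ψ)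

/-- `‖ψ‖_{C^k(S^{d-1})} = ∑_{|α| ≤ k} sup_w |∇_S^α ψ(w)|`, with values in `[0, ∞]`. -/
def ckNorm (k : ℕ) (ψ : Sph d → ℝ) : ℝ≥0∞ :=
  ∑ m ∈ Finset.range (k + 1), ∑ α : Fin m → Fin d, ⨆ w : Sph d, ‖iterGrad m α ψ w‖ₑ

end Oja

end

/-! The key is to extend functions on the sphere to be homogeneous of degree 0. The extension
forgets the normalization, so `ext (op ν η ψ) x` is the average of `ext ψ` over the points `lin η ξ
x`, where `lin η ξ` is the linear map `I + η ξ ξᵀ` (`ext_op`). This map does not shrink vectors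
(`norm_le_norm_lin`) and has norm at most `1 + η R²` for almost every `ξ`.

For `C^k`, the `m`-th derivative of `ext ψ ∘ lin η ξ` is that of `ext ψ` at `lin η ξ x` with `lin η
ξ` in each slot. The derivative is homogeneous of degree `-m`, so moving outwards does not increase
its bound. One step therefore multiplies the bound for order `m` by at most `(1 + η R²) ^ m`, with
no contribution from other orders (`norm_D_op_le`). After `n` steps with `n η ≤ T` the factor is at
most `exp (T R² k)`. Since `∇_S^i ψ` extends to `‖x‖ ∂_i (ext ψ)` (`ext_grad`), Euclidean and
spherical derivatives control each other (`exists_iterGrad_le`, `exists_norm_D_le`).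

For `L^∞`, `lin η ξ` is invertible, so preimages of null cones are null and `step η ξ` pulls null
sets of the sphere back to null sets (`quasiMeasurePreserving_step`). For `L^1`, the image of `ρ dS
⊗ ν` under the step is then absolutely continuous, and `S^* ρ` is its Radon–Nikodym density. Testing
against signs, indicators and `1` gives contraction, positivity and conservation of mass. -/

noncomputable section

open Filter Set
open scoped Topology Pointwise

/-! ### Higher derivatives of integrals depending on a parameter -/

/-- Differentiation under the integral, one order at a time. Local bounds uniform in `ω` dominate
because `μ` is finite. The Taylor series form also identifies the derivatives of the integral, which
the later norm estimates use. -/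
theorem hasFTaylorSeriesUpToOn_integral {Ω V F : Type*} [MeasurableSpace Ω] {μ : Measure Ω}
    [IsFiniteMeasure μ] [NormedAddCommGroup V] [NormedSpace ℝ V] [NormedAddCommGroup F]
    [NormedSpace ℝ F] [CompleteSpace F] {f : Ω → V → F} {s : Set V} (hs : IsOpen s) {k : ℕ}
    (hf : ∀ ω, ContDiffOn ℝ k (f ω) s)
    (hm : ∀ m ≤ k, ∀ x ∈ s, AEStronglyMeasurable (fun ω => iteratedFDerivWithin ℝ m (f ω) s x) μ)
    (hb : ∀ m ≤ k, ∀ x ∈ s, ∃ C : ℝ, ∃ t ∈ 𝓝 x, ∀ᵐ ω ∂μ, ∀ y ∈ t,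
      ‖iteratedFDerivWithin ℝ m (f ω) s y‖ ≤ C) :
    HasFTaylorSeriesUpToOn k (fun x => ∫ ω, f ω x ∂μ)
      (fun x m => ∫ ω, iteratedFDerivWithin ℝ m (f ω) s x ∂μ) s := by
  have hT (ω : Ω) := (hf ω).ftaylorSeriesWithin hs.uniqueDiffOn
  have hint (m : ℕ) (hmk : m ≤ k) (x : V) (hx : x ∈ s) :
      Integrable (fun ω => iteratedFDerivWithin ℝ m (f ω) s x) μ := by
    obtain ⟨C, t, ht, hC⟩ := hb m hmk x hx
    exact Integrable.of_bound (hm m hmk x hx) C (hC.mono fun ω h => h x (mem_of_mem_nhds ht))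
  refine ⟨fun x hx => ?_, fun m hmk x hx => ?_, fun m hmk x hx => ?_⟩
  · refine ((continuousMultilinearCurryFin0 ℝ V F).toContinuousLinearEquiv.toContinuousLinearMap
      |>.integral_comp_comm (hint 0 (Nat.zero_le k) x hx)).symm.trans ?_
    exact integral_congr_ae (ae_of_all _ fun ω => (hT ω).zero_eq x hx)
  · have hmk' : m < k := by exact_mod_cast hmk
    obtain ⟨C, t, ht, hC⟩ := hb (m + 1) hmk' x hx
    have key : HasFDerivAt (fun y => ∫ ω, iteratedFDerivWithin ℝ m (f ω) s y ∂μ)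
        (∫ ω, (iteratedFDerivWithin ℝ (m + 1) (f ω) s x).curryLeft ∂μ) x := by
      refine hasFDerivAt_integral_of_dominated_of_fderiv_le (s := t ∩ s)
        (F' := fun y ω => (iteratedFDerivWithin ℝ (m + 1) (f ω) s y).curryLeft)
        (bound := fun _ => C) (inter_mem ht (hs.mem_nhds hx)) ?_ (hint m hmk'.le x hx) ?_ ?_
        (integrable_const C) ?_
      · filter_upwards [hs.mem_nhds hx] with y hy using hm m hmk'.le y hy
      · exact (continuousMultilinearCurryLeftEquiv ℝ (fun _ : Fin (m + 1) => V) F).continuous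
          |>.comp_aestronglyMeasurable (hm (m + 1) hmk' x hx)
      · filter_upwards [hC] with ω hω y hy
        rw [ContinuousMultilinearMap.curryLeft_norm]
        exact hω y hy.1
      · exact ae_of_all _ fun ω y hy =>
          ((hT ω).fderivWithin m hmk y hy.2).hasFDerivAt (hs.mem_nhds hy.2)
    convert key.hasFDerivWithinAt using 1
    exact (ContinuousLinearMap.integral_comp_comm (𝕜 := ℝ) (Fₗ := V →L[ℝ] V [×m]→L[ℝ] F)
      (continuousMultilinearCurryLeftEquiv ℝ (fun _ : Fin (m + 1) => V)
        F).toContinuousLinearEquiv.toContinuousLinearMap (hint (m + 1) hmk' x hx)).symm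
  · have hmk' : m ≤ k := by exact_mod_cast hmk
    obtain ⟨C, t, ht, hC⟩ := hb m hmk' x hx
    refine (continuousAt_of_dominated (bound := fun _ => C) ?_ ?_ (integrable_const C)
      ?_).continuousWithinAt
    · filter_upwards [hs.mem_nhds hx] with y hy using hm m hmk' y hy
    · filter_upwards [ht] with y hy
      filter_upwards [hC] with ω hω using hω y hy
    · exact ae_of_all _ fun ω => ((hT ω).cont m hmk).continuousAt (hs.mem_nhds hx)

namespace Oja

variable {d : ℕ}

/-! ### The linear map `I + η ξ ξᵀ` and the normalization -/

/-- The linear map `x ↦ x + η ξ ξᵀ x`. -/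
def lin (η : ℝ≥0) (ξ : E d) : E d →L[ℝ] E d :=
  ContinuousLinearMap.id ℝ (E d) + (η : ℝ) • (innerSL ℝ ξ).smulRight ξ

theorem lin_apply (η : ℝ≥0) (ξ x : E d) :
    lin η ξ x = x + ((η : ℝ) * inner ℝ ξ x) • ξ := by
  simp [lin, smul_smul]

/-- Pairing with `x` gives `‖x‖² + η ⟨ξ, x⟩²`; conclude by Cauchy–Schwarz. This yields injectivity
and also controls negative powers of `‖lin η ξ x‖`. -/
theorem norm_le_norm_lin (η : ℝ≥0) (ξ x : E d) : ‖x‖ ≤ ‖lin η ξ x‖ := by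
  have h1 : inner ℝ (lin η ξ x) x = ‖x‖ ^ 2 + η * inner ℝ ξ x ^ 2 := by
    rw [lin_apply, inner_add_left, real_inner_self_eq_norm_sq, real_inner_smul_left]
    ring
  have h2 : inner ℝ (lin η ξ x) x ≤ ‖lin η ξ x‖ * ‖x‖ := real_inner_le_norm _ _
  have h3 : 0 ≤ (η : ℝ) * inner ℝ ξ x ^ 2 := by positivity
  rcases (norm_nonneg x).eq_or_lt with h | h
  · rw [← h]; exact norm_nonneg _
  · exact le_of_mul_le_mul_right (by nlinarith) h

theorem lin_ne_zero (η : ℝ≥0) (ξ : E d) {x : E d} (hx : x ≠ 0) : lin η ξ x ≠ 0 :=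
  norm_pos_iff.mp ((norm_pos_iff.mpr hx).trans_le (norm_le_norm_lin η ξ x))

theorem lin_preimage (η : ℝ≥0) (ξ : E d) : lin η ξ ⁻¹' {0}ᶜ = {0}ᶜ := by
  ext x
  refine ⟨fun h hx => h ?_, fun h => lin_ne_zero η ξ h⟩
  rw [mem_singleton_iff.mp hx]
  exact map_zero _

theorem norm_lin_le (η : ℝ≥0) (ξ : E d) : ‖lin η ξ‖ ≤ 1 + η * ‖ξ‖ ^ 2 := by
  refine ContinuousLinearMap.opNorm_le_bound _ (by positivity) fun x => ?_
  rw [lin_apply]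
  refine (norm_add_le _ _).trans ?_
  rw [norm_smul, norm_mul, Real.norm_eq_abs, abs_of_nonneg η.coe_nonneg]
  calc ‖x‖ + η * ‖inner ℝ ξ x‖ * ‖ξ‖ = ‖x‖ + η * ‖ξ‖ * ‖inner ℝ ξ x‖ := by ring
    _ ≤ ‖x‖ + η * ‖ξ‖ * (‖ξ‖ * ‖x‖) := by gcongr; exact norm_inner_le_norm ξ x
    _ = _ := by ring

theorem continuous_lin (η : ℝ≥0) : Continuous (lin η : E d → E d →L[ℝ] E d) := by
  unfold lin
  have h : Continuous fun ξ : E d => (innerSL ℝ ξ).smulRight ξ :=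
    ((ContinuousLinearMap.smulRightL ℝ (E d) (E d)).continuous.comp
      (innerSL ℝ).continuous).clm_apply continuous_id
  exact continuous_const.add (h.const_smul (η : ℝ))

theorem coe_ne_zero (w : Sph d) : (w : E d) ≠ 0 := ne_zero_of_mem_unit_sphere w

theorem Q_coe (w : Sph d) : Q (w : E d) (coe_ne_zero w) = w :=
  Subtype.ext (by simp [Q])

theorem Q_congr {x y : E d} (h : x = y) (hx : x ≠ 0) : Q x hx = Q y (h ▸ hx) := by
  subst h; rfl

theorem Q_smul {c : ℝ} (hc : 0 < c) {x : E d} (hx : x ≠ 0) (hcx : c • x ≠ 0) :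
    Q (c • x) hcx = Q x hx := by
  apply Subtype.ext
  have : ‖x‖ ≠ 0 := norm_ne_zero_iff.mpr hx
  simp only [Q, norm_smul, Real.norm_eq_abs, abs_of_pos hc, smul_smul]
  congr 1
  field_simp

theorem step_eq (η : ℝ≥0) (ξ : E d) (w : Sph d) :
    step η ξ w = Q (lin η ξ w) (lin_ne_zero η ξ (coe_ne_zero w)) :=
  Q_congr (lin_apply η ξ w).symm _

theorem step_Q (η : ℝ≥0) (ξ : E d) {x : E d} (hx : x ≠ 0) :
    step η ξ (Q x hx) = Q (lin η ξ x) (lin_ne_zero η ξ hx) := by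
  have hc : 0 < ‖x‖⁻¹ := inv_pos.mpr (norm_pos_iff.mpr hx)
  rw [step_eq, ← Q_smul hc (lin_ne_zero η ξ hx) (smul_ne_zero hc.ne' (lin_ne_zero η ξ hx))]
  exact Q_congr (map_smul (lin η ξ) _ _) _

theorem continuous_step (η : ℝ≥0) : Continuous fun p : Sph d × E d => step η p.2 p.1 := by
  unfold step Q
  refine Continuous.subtype_mk ?_ _
  have h : Continuous fun p : Sph d × E d =>
      (p.1 : E d) + ((η : ℝ) * inner ℝ p.2 (p.1 : E d)) • p.2 := by fun_prop
  exact (h.norm.inv₀ fun p => norm_ne_zero_iff.mpr (ne_zero_of_sphere η p.2 p.1)).smul h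

theorem measurable_step (η : ℝ≥0) : Measurable fun p : Sph d × E d => step η p.2 p.1 :=
  (continuous_step η).measurable

/-! ### Null sets of the surface measure -/

/-- The surface measure of `N` is the dimension times the volume of the truncated cone over `N`, and
integer dilates of that truncated cone cover the full cone. -/
theorem volume_cone_eq_zero {N : Set (Sph d)} (hN : MeasurableSet N) (h0 : surf d N = 0) :
    volume {x : E d | ∃ hx : x ≠ 0, Q x hx ∈ N} = 0 := by
  rw [Measure.toSphere_apply' _ hN] at h0
  rcases mul_eq_zero.mp h0 with h | h
  -- In dimension 0 the dimension factor vanishes, but then there are no nonzero vectors.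
  · have : Subsingleton (E d) := Module.finrank_zero_iff.mp (by exact_mod_cast h)
    rw [show {x : E d | ∃ hx : x ≠ 0, Q x hx ∈ N} = ∅ from
      eq_empty_of_forall_notMem fun x ⟨hx, _⟩ => hx (Subsingleton.elim _ _), measure_empty]
  · refine measure_mono_null (t := ⋃ n : ℕ, (n : ℝ) • (Ioo (0 : ℝ) 1 • ((↑) '' N : Set (E d)))) ?_
      (measure_iUnion_null fun n => by rw [Measure.addHaar_smul, h, mul_zero])
    rintro x ⟨hx, hxN⟩
    have hx' : 0 < ‖x‖ := norm_pos_iff.mpr hx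
    obtain ⟨n, hn⟩ := exists_nat_gt ‖x‖
    have hn' : (0 : ℝ) < n := hx'.trans hn
    refine mem_iUnion.mpr ⟨n, ?_⟩
    refine ⟨((n : ℝ)⁻¹ * ‖x‖) • (Q x hx : E d), smul_mem_smul ⟨by positivity, ?_⟩
      (mem_image_of_mem _ hxN), ?_⟩
    · rw [inv_mul_lt_one₀ hn']; exact hn
    · simp only [Q, smul_smul]
      convert one_smul ℝ x using 2
      field_simp

theorem surf_eq_zero_of_cone {N : Set (Sph d)} (hN : MeasurableSet N)
    (h0 : volume {x : E d | ∃ hx : x ≠ 0, Q x hx ∈ N} = 0) : surf d N = 0 := by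
  rw [Measure.toSphere_apply' _ hN]
  refine mul_eq_zero_of_right _ (measure_mono_null ?_ h0)
  rintro _ ⟨r, hr, _, ⟨w, hw, rfl⟩, rfl⟩
  refine ⟨smul_ne_zero hr.1.ne' (coe_ne_zero w), ?_⟩
  change Q (r • (w : E d)) _ ∈ N
  rwa [Q_smul hr.1 (coe_ne_zero w), Q_coe]

/-- On cones the step is the linear bijection `lin η ξ`, and invertible linear maps preserve
Lebesgue null sets. -/
theorem quasiMeasurePreserving_step (η : ℝ≥0) (ξ : E d) :
    Measure.QuasiMeasurePreserving (step η ξ) (surf d) (surf d) := by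
  have hm : Measurable (step η ξ) :=
    (measurable_step η).comp (g := fun p : Sph d × E d => step η p.2 p.1) (f := fun w => (w, ξ))
      measurable_prodMk_right
  refine ⟨hm, Measure.AbsolutelyContinuous.mk fun N hN h0 => ?_⟩
  rw [Measure.map_apply hm hN]
  refine surf_eq_zero_of_cone (hm hN) ?_
  have hdet : LinearMap.det (lin η ξ : E d →ₗ[ℝ] E d) ≠ 0 := by
    intro h
    obtain ⟨x, hx, hx0⟩ := Submodule.exists_mem_ne_zero_of_ne_bot
      (LinearMap.bot_lt_ker_of_det_eq_zero h).ne'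
    exact lin_ne_zero η ξ hx0 hx
  have := Measure.addHaar_preimage_linearMap (volume : Measure (E d)) hdet
    {x : E d | ∃ hx : x ≠ 0, Q x hx ∈ N}
  rw [volume_cone_eq_zero hN h0, mul_zero] at this
  refine measure_mono_null ?_ this
  rintro x ⟨hx, hxN⟩
  exact ⟨lin_ne_zero η ξ hx, by rw [mem_preimage, step_Q] at hxN; exact hxN⟩

theorem quasiMeasurePreserving_step_prod (ν : Measure (E d)) [SFinite ν] (η : ℝ≥0) :
    Measure.QuasiMeasurePreserving (fun p : Sph d × E d => step η p.2 p.1)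
      ((surf d).prod ν) (surf d) :=
  QuasiMeasurePreserving.prod_of_left (measurable_step η)
    (ae_of_all _ fun ξ => quasiMeasurePreserving_step η ξ)

/-- This makes `S` independent of the representative: from almost every `w`, a null set is hit for
`ν`-almost no `ξ`. By Fubini no regularity of `ν` is needed. -/
theorem ae_ae_step (ν : Measure (E d)) [SFinite ν] (η : ℝ≥0) {P : Sph d → Prop}
    (h : ∀ᵐ w ∂surf d, P w) : ∀ᵐ w ∂surf d, ∀ᵐ ξ ∂ν, P (step η ξ w) :=
  Measure.ae_ae_of_ae_prod ((quasiMeasurePreserving_step_prod ν η).ae h)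

/-! ### The operator on `L^∞` -/

theorem op_nonneg (ν : Measure (E d)) (η : ℝ≥0) {u : Sph d → ℝ} (hu : ∀ w, 0 ≤ u w) (w : Sph d) :
    0 ≤ op ν η u w :=
  integral_nonneg fun _ => hu _

section Operator

variable (ν : Measure (E d)) [IsProbabilityMeasure ν] (η : ℝ≥0)

theorem op_ae_congr {u v : Sph d → ℝ} (h : u =ᵐ[surf d] v) : op ν η u =ᵐ[surf d] op ν η v := by
  filter_upwards [ae_ae_step ν η h] with w hw using integral_congr_ae hw

theorem aestronglyMeasurable_comp_step {u : Sph d → ℝ} (hu : AEStronglyMeasurable u (surf d)) :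
    AEStronglyMeasurable (fun p : Sph d × E d => u (step η p.2 p.1)) ((surf d).prod ν) :=
  hu.comp_quasiMeasurePreserving (quasiMeasurePreserving_step_prod ν η)

theorem aestronglyMeasurable_op {u : Sph d → ℝ} (hu : AEStronglyMeasurable u (surf d)) :
    AEStronglyMeasurable (op ν η u) (surf d) :=
  (aestronglyMeasurable_comp_step ν η hu).integral_prod_right'

theorem enorm_op_le {u : Sph d → ℝ} {C : ℝ≥0∞} (h : ∀ᵐ w ∂surf d, ‖u w‖ₑ ≤ C) :
    ∀ᵐ w ∂surf d, ‖op ν η u w‖ₑ ≤ C := by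
  filter_upwards [ae_ae_step ν η h] with w hw
  calc ‖op ν η u w‖ₑ ≤ ∫⁻ ξ, ‖u (step η ξ w)‖ₑ ∂ν := enorm_integral_le_lintegral_enorm _
    _ ≤ ∫⁻ _, C ∂ν := lintegral_mono_ae hw
    _ = C := by simp

theorem eLpNorm_op_le (u : Sph d → ℝ) : eLpNorm (op ν η u) ∞ (surf d) ≤ eLpNorm u ∞ (surf d) := by
  simp only [eLpNorm_exponent_top]
  exact essSup_le_of_ae_le _ (enorm_op_le ν η ae_le_eLpNormEssSup)

theorem memLp_op {u : Sph d → ℝ} (hu : MemLp u ∞ (surf d)) : MemLp (op ν η u) ∞ (surf d) :=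
  ⟨aestronglyMeasurable_op ν η hu.1, (eLpNorm_op_le ν η u).trans_lt hu.2⟩

theorem ae_integrable_comp_step {u : Sph d → ℝ} (hu : MemLp u ∞ (surf d)) :
    ∀ᵐ w ∂surf d, Integrable (fun ξ => u (step η ξ w)) ν :=
  (((hu.integrable le_top).1.comp_quasiMeasurePreserving
    (quasiMeasurePreserving_step_prod ν η)).prodMk_left.and
      (ae_ae_step ν η (ae_le_eLpNormEssSup (f := u) (μ := surf d)))).mono fun w hw =>
    Integrable.of_bound hw.1 (eLpNormEssSup u (surf d)).toReal <| hw.2.mono fun ξ hξ => by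
      rw [← toReal_enorm]
      exact ENNReal.toReal_mono (by simpa [eLpNorm_exponent_top] using hu.2.ne) hξ

/-- The operator `S` on `L^∞`. -/
def opL : Lp ℝ ∞ (surf d) →L[ℝ] Lp ℝ ∞ (surf d) :=
  LinearMap.mkContinuous
    { toFun := fun u => (memLp_op ν η (Lp.memLp u)).toLp _
      map_add' := fun u v => by
        rw [← MemLp.toLp_add, MemLp.toLp_eq_toLp_iff]
        filter_upwards [op_ae_congr ν η (Lp.coeFn_add u v),
          ae_integrable_comp_step ν η (Lp.memLp u), ae_integrable_comp_step ν η (Lp.memLp v)] with w hw hu hv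
        rw [hw]
        exact integral_add hu hv
      map_smul' := fun c u => by
        rw [RingHom.id_apply, ← MemLp.toLp_const_smul, MemLp.toLp_eq_toLp_iff]
        filter_upwards [op_ae_congr ν η (Lp.coeFn_smul c u)] with w hw
        rw [hw]
        exact integral_smul c _ }
    1 fun u => by
      rw [one_mul, LinearMap.coe_mk, AddHom.coe_mk, Lp.norm_toLp, Lp.norm_def]
      exact ENNReal.toReal_mono (Lp.memLp u).2.ne (eLpNorm_op_le ν η u)

theorem opL_ae (u : Lp ℝ ∞ (surf d)) : opL ν η u =ᵐ[surf d] op ν η u :=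
  MemLp.coeFn_toLp (memLp_op ν η (Lp.memLp u))

theorem norm_opL_le (u : Lp ℝ ∞ (surf d)) : ‖opL ν η u‖ ≤ ‖u‖ := by
  simpa using (opL ν η).le_of_opNorm_le (LinearMap.mkContinuous_norm_le _ zero_le_one _) u

/-! ### The predual operator on `L^1` -/

theorem op_one : op ν η 1 = (1 : Sph d → ℝ) := by
  funext w; simp [op]

theorem integrable_op_mul {u ρ : Sph d → ℝ} (hu : MemLp u ∞ (surf d))
    (hρ : Integrable ρ (surf d)) : Integrable (fun w => op ν η u w * ρ w) (surf d) :=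
  hρ.essSup_smul (memLp_op ν η hu).1 (by
    simpa [eLpNorm_exponent_top, eLpNormEssSup] using (memLp_op ν η hu).2.ne)

theorem integrable_mul {u ρ : Sph d → ℝ} (hu : MemLp u ∞ (surf d))
    (hρ : Integrable ρ (surf d)) : Integrable (fun w => u w * ρ w) (surf d) :=
  hρ.essSup_smul hu.1 (by simpa [eLpNorm_exponent_top, eLpNormEssSup] using hu.2.ne)

/-- If the state has density `ρ`, then `π` is the law, up to total mass, of the state after one
step. It is absolutely continuous by `quasiMeasurePreserving_step_prod`, and its density is the
required `g`. -/
theorem exists_predual_of_nonneg {ρ : Sph d → ℝ} (hρ : Integrable ρ (surf d))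
    (h0 : ∀ w, 0 ≤ ρ w) (hm : Measurable ρ) :
    ∃ g : Sph d → ℝ, Integrable g (surf d) ∧ ∀ u : Sph d → ℝ, MemLp u ∞ (surf d) →
      ∫ w, op ν η u w * ρ w ∂surf d = ∫ w, u w * g w ∂surf d := by
  set μ : Measure (Sph d) := (surf d).withDensity fun w => ENNReal.ofReal (ρ w) with hμ
  have hac : μ ≪ surf d := withDensity_absolutelyContinuous _ _
  have hfin : IsFiniteMeasure μ := isFiniteMeasure_withDensity_ofReal hρ.2
  set π : Measure (Sph d) := (μ.prod ν).map fun p => step η p.2 p.1 with hπ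
  have hpac : π ≪ surf d :=
    ((hac.prod Measure.AbsolutelyContinuous.rfl).map (measurable_step η)).trans
      (quasiMeasurePreserving_step_prod ν η).absolutelyContinuous
  have : IsFiniteMeasure π := Measure.isFiniteMeasure_map _ _
  have : SigmaFinite (surf d) := IsFiniteMeasure.toSigmaFinite _
  have : SigmaFinite π := IsFiniteMeasure.toSigmaFinite _
  refine ⟨fun w => (π.rnDeriv (surf d) w).toReal, Measure.integrable_toReal_rnDeriv,
    fun u hu => ?_⟩
  have huπ : AEStronglyMeasurable u π := hu.1.mono_ac hpac
  have hint : Integrable u π :=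
    Integrable.of_bound huπ (eLpNormEssSup u (surf d)).toReal <|
      ((ae_le_eLpNormEssSup (f := u) (μ := surf d)).filter_mono hpac.ae_le).mono fun w hw => by
        rw [← toReal_enorm]
        exact ENNReal.toReal_mono (by simpa [eLpNorm_exponent_top] using hu.2.ne) hw
  calc ∫ w, op ν η u w * ρ w ∂surf d
      = ∫ w, (ENNReal.ofReal (ρ w)).toReal • op ν η u w ∂surf d := by
        refine integral_congr_ae (ae_of_all _ fun w => ?_)
        simp only [ENNReal.toReal_ofReal (h0 w), smul_eq_mul]
        ring
    _ = ∫ w, op ν η u w ∂μ :=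
        (integral_withDensity_eq_integral_toReal_smul hm.ennreal_ofReal
          (ae_of_all _ fun _ => ENNReal.ofReal_lt_top) _).symm
    _ = ∫ p, u (step η p.2 p.1) ∂(μ.prod ν) := by
        exact (integral_prod (fun p : Sph d × E d => u (step η p.2 p.1))
          (hint.comp_measurable (measurable_step η))).symm
    _ = ∫ w, u w ∂π := (integral_map (measurable_step η).aemeasurable huπ).symm
    _ = ∫ w, (π.rnDeriv (surf d) w).toReal • u w ∂surf d := (integral_rnDeriv_smul hpac).symm
    _ = _ := by simp only [smul_eq_mul, mul_comm]

theorem exists_predual (ρ : Lp ℝ 1 (surf d)) :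
    ∃ g : Lp ℝ 1 (surf d), ∀ u : Sph d → ℝ, MemLp u ∞ (surf d) →
      ∫ w, op ν η u w * ρ w ∂surf d = ∫ w, u w * g w ∂surf d := by
  have hρ : Integrable ρ (surf d) := L1.integrable_coeFn ρ
  have hm : Measurable ρ := (Lp.stronglyMeasurable ρ).measurable
  obtain ⟨g₁, h₁, e₁⟩ := exists_predual_of_nonneg ν η hρ.pos_part (fun w => le_max_right _ _)
    (hm.max measurable_const)
  obtain ⟨g₂, h₂, e₂⟩ := exists_predual_of_nonneg ν η hρ.neg_part (fun w => le_max_right _ _)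
    (hm.neg.max measurable_const)
  refine ⟨(h₁.sub h₂).toL1 _, fun u hu => ?_⟩
  calc ∫ w, op ν η u w * ρ w ∂surf d
      = ∫ w, (op ν η u w * max (ρ w) 0 - op ν η u w * max (-ρ w) 0) ∂surf d := by
        refine integral_congr_ae (ae_of_all _ fun w => ?_)
        simp only
        rw [← mul_sub, max_zero_sub_max_neg_zero_eq_self]
    _ = ∫ w, u w * g₁ w ∂surf d - ∫ w, u w * g₂ w ∂surf d := by
        rw [integral_sub (integrable_op_mul ν η hu hρ.pos_part)
          (integrable_op_mul ν η hu hρ.neg_part), e₁ u hu, e₂ u hu]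
    _ = ∫ w, (u w * g₁ w - u w * g₂ w) ∂surf d :=
        (integral_sub (integrable_mul hu h₁) (integrable_mul hu h₂)).symm
    _ = _ := by
        refine integral_congr_ae ?_
        filter_upwards [(h₁.sub h₂).coeFn_toL1] with w hw
        rw [hw, Pi.sub_apply, mul_sub]

/-- The density `S^* ρ`. -/
def predual (ρ : Lp ℝ 1 (surf d)) : Lp ℝ 1 (surf d) := (exists_predual ν η ρ).choose

theorem predual_spec (ρ : Lp ℝ 1 (surf d)) {u : Sph d → ℝ} (hu : MemLp u ∞ (surf d)) :
    ∫ w, op ν η u w * ρ w ∂surf d = ∫ w, u w * predual ν η ρ w ∂surf d :=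
  (exists_predual ν η ρ).choose_spec u hu

theorem memLp_indicator {s : Set (Sph d)} (hs : MeasurableSet s) :
    MemLp (s.indicator (1 : Sph d → ℝ)) ∞ (surf d) :=
  (memLp_top_const (1 : ℝ)).indicator hs

theorem integral_indicator_mul {s : Set (Sph d)} (hs : MeasurableSet s) (g : Sph d → ℝ) :
    ∫ w, s.indicator (1 : Sph d → ℝ) w * g w ∂surf d = ∫ w in s, g w ∂surf d := by
  rw [← integral_indicator hs]
  refine integral_congr_ae (ae_of_all _ fun w => ?_)
  by_cases hw : w ∈ s <;> simp [hw]

/-- Indicators as test functions determine the density. Since `predual` is obtained by choice, its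
linearity has to come from this uniqueness. -/
theorem predual_unique {ρ g : Lp ℝ 1 (surf d)}
    (h : ∀ u : Sph d → ℝ, MemLp u ∞ (surf d) →
      ∫ w, op ν η u w * ρ w ∂surf d = ∫ w, u w * g w ∂surf d) : predual ν η ρ = g := by
  refine Lp.ext (Integrable.ae_eq_of_forall_setIntegral_eq _ _ (L1.integrable_coeFn _)
    (L1.integrable_coeFn _) fun s hs _ => ?_)
  rw [← integral_indicator_mul hs, ← integral_indicator_mul hs,
    ← predual_spec ν η ρ (memLp_indicator hs), h _ (memLp_indicator hs)]

theorem predual_add (ρ σ : Lp ℝ 1 (surf d)) :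
    predual ν η (ρ + σ) = predual ν η ρ + predual ν η σ := by
  refine predual_unique ν η fun u hu => ?_
  have h (f : Sph d → ℝ) (a b : Lp ℝ 1 (surf d)) :
      (fun w => f w * (a + b : Lp ℝ 1 (surf d)) w) =ᵐ[surf d] fun w => f w * a w + f w * b w := by
    filter_upwards [Lp.coeFn_add a b] with w hw
    rw [hw, Pi.add_apply, mul_add]
  rw [integral_congr_ae (h _ ρ σ), integral_congr_ae (h _ _ _),
    integral_add (integrable_op_mul ν η hu (L1.integrable_coeFn ρ))
      (integrable_op_mul ν η hu (L1.integrable_coeFn σ)),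
    integral_add (integrable_mul hu (L1.integrable_coeFn _))
      (integrable_mul hu (L1.integrable_coeFn _)),
    predual_spec ν η ρ hu, predual_spec ν η σ hu]

theorem predual_smul (c : ℝ) (ρ : Lp ℝ 1 (surf d)) :
    predual ν η (c • ρ) = c • predual ν η ρ := by
  refine predual_unique ν η fun u hu => ?_
  have h (f : Sph d → ℝ) (a : Lp ℝ 1 (surf d)) :
      (fun w => f w * (c • a : Lp ℝ 1 (surf d)) w) =ᵐ[surf d] fun w => c * (f w * a w) := by
    filter_upwards [Lp.coeFn_smul c a] with w hw
    rw [hw, Pi.smul_apply, smul_eq_mul]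
    ring
  rw [integral_congr_ae (h _ ρ), integral_congr_ae (h _ _), integral_const_mul,
    integral_const_mul, predual_spec ν η ρ hu]

theorem norm_eq_integral_sign_mul (g : Lp ℝ 1 (surf d)) :
    ‖g‖ = ∫ w, Real.sign (g w) * g w ∂surf d := by
  rw [L1.norm_eq_integral_norm]
  refine integral_congr_ae (ae_of_all _ fun w => ?_)
  simp only [Real.norm_eq_abs]
  rcases lt_trichotomy (g w) 0 with h | h | h
  · rw [Real.sign_of_neg h, abs_of_neg h]; ring
  · simp [h]
  · rw [Real.sign_of_pos h, abs_of_pos h]; ring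

theorem abs_sign_le_one (x : ℝ) : ‖Real.sign x‖ ≤ 1 := by
  rcases Real.sign_apply_eq x with h | h | h <;> simp [h]

theorem measurable_sign : Measurable Real.sign := by
  unfold Real.sign
  exact Measurable.ite measurableSet_Iio measurable_const
    (Measurable.ite measurableSet_Ioi measurable_const measurable_const)

theorem norm_predual_le (ρ : Lp ℝ 1 (surf d)) : ‖predual ν η ρ‖ ≤ ‖ρ‖ := by
  have hs : MemLp (fun w => Real.sign (predual ν η ρ w)) ∞ (surf d) :=
    memLp_top_of_bound (measurable_sign.comp
      (Lp.stronglyMeasurable _).measurable).aestronglyMeasurable 1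
      (ae_of_all _ fun w => abs_sign_le_one _)
  -- The sign of `S^* ρ` is the test function attaining its norm; `op` keeps that function bounded
  -- by 1.
  rw [norm_eq_integral_sign_mul, ← predual_spec ν η ρ hs, L1.norm_eq_integral_norm]
  refine (Real.le_norm_self _).trans ((norm_integral_le_integral_norm _).trans ?_)
  refine integral_mono (integrable_op_mul ν η hs (L1.integrable_coeFn ρ)).norm
    (L1.integrable_coeFn ρ).norm fun w => ?_
  simp only [norm_mul]
  refine mul_le_of_le_one_left (norm_nonneg _) ?_
  refine (norm_integral_le_of_norm_le_const (C := 1) (ae_of_all _ fun ξ => ?_)).trans (by simp)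
  exact abs_sign_le_one _

theorem predual_nonneg {ρ : Lp ℝ 1 (surf d)} (hρ : 0 ≤ ρ) : 0 ≤ predual ν η ρ := by
  rw [← Lp.coeFn_nonneg] at hρ ⊢
  refine ae_nonneg_of_forall_setIntegral_nonneg (L1.integrable_coeFn _) fun s hs _ => ?_
  rw [← integral_indicator_mul hs, ← predual_spec ν η ρ (memLp_indicator hs)]
  refine integral_nonneg_of_ae (hρ.mono fun w hw => mul_nonneg (op_nonneg ν η (fun v => ?_) w) hw)
  exact indicator_nonneg (fun _ _ => zero_le_one) v

theorem norm_eq_integral_of_nonneg {g : Lp ℝ 1 (surf d)} (hg : 0 ≤ g) :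
    ‖g‖ = ∫ w, (1 : Sph d → ℝ) w * g w ∂surf d := by
  rw [L1.norm_eq_integral_norm]
  refine integral_congr_ae (((Lp.coeFn_nonneg g).mpr hg).mono fun w hw => ?_)
  simp only [Pi.one_apply, one_mul]
  exact Real.norm_of_nonneg hw

theorem norm_predual_of_nonneg {ρ : Lp ℝ 1 (surf d)} (hρ : 0 ≤ ρ) :
    ‖predual ν η ρ‖ = ‖ρ‖ := by
  rw [norm_eq_integral_of_nonneg (predual_nonneg ν η hρ), norm_eq_integral_of_nonneg hρ,
    ← predual_spec ν η ρ (u := 1) (memLp_top_const (1 : ℝ)), op_one]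

/-- The operator `S^*` on `L^1`. -/
def predualL : Lp ℝ 1 (surf d) →L[ℝ] Lp ℝ 1 (surf d) :=
  LinearMap.mkContinuous
    { toFun := predual ν η
      map_add' := predual_add ν η
      map_smul' := predual_smul ν η }
    1 fun ρ => by simpa using norm_predual_le ν η ρ

theorem exists_operators :
    ∃ S : Lp ℝ ∞ (surf d) →L[ℝ] Lp ℝ ∞ (surf d),
      (∀ (u : Sph d → ℝ) (hu : MemLp u ∞ (surf d)), S (hu.toLp u) =ᵐ[surf d] op ν η u) ∧
      (∀ u, ‖S u‖ ≤ ‖u‖) ∧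
      ∃ Sstar : Lp ℝ 1 (surf d) →L[ℝ] Lp ℝ 1 (surf d),
        (∀ (u : Lp ℝ ∞ (surf d)) (ρ : Lp ℝ 1 (surf d)),
          ∫ w, (S u) w * ρ w ∂(surf d) = ∫ w, u w * (Sstar ρ) w ∂(surf d)) ∧
        (∀ ρ, ‖Sstar ρ‖ ≤ ‖ρ‖) ∧
        (∀ ρ, 0 ≤ ρ → 0 ≤ Sstar ρ ∧ ‖Sstar ρ‖ = ‖ρ‖) := by
  refine ⟨opL ν η, fun u hu => (opL_ae ν η _).trans (op_ae_congr ν η hu.coeFn_toLp),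
    norm_opL_le ν η, predualL ν η, fun u ρ => ?_, norm_predual_le ν η,
    fun ρ hρ => ⟨predual_nonneg ν η hρ, norm_predual_of_nonneg ν η hρ⟩⟩
  refine Eq.trans (integral_congr_ae ?_) (predual_spec ν η ρ (Lp.memLp u))
  filter_upwards [opL_ae ν η u] with w hw
  rw [hw]

end Operator

/-! ### The extension of a function on the sphere -/

theorem ext_of_ne (ψ : Sph d → ℝ) {x : E d} (hx : x ≠ 0) : ext ψ x = ψ (Q x hx) := dif_pos hx

theorem ext_coe (ψ : Sph d → ℝ) (w : Sph d) : ext ψ (w : E d) = ψ w := by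
  rw [ext_of_ne ψ (coe_ne_zero w), Q_coe]

theorem ext_smul (ψ : Sph d → ℝ) {c : ℝ} (hc : 0 < c) (x : E d) : ext ψ (c • x) = ext ψ x := by
  by_cases hx : x = 0
  · simp [hx]
  · rw [ext_of_ne ψ (smul_ne_zero hc.ne' hx), ext_of_ne ψ hx, Q_smul hc hx]

theorem ext_op (ν : Measure (E d)) (η : ℝ≥0) (ψ : Sph d → ℝ) {x : E d} (hx : x ≠ 0) :
    ext (op ν η ψ) x = ∫ ξ, ext ψ (lin η ξ x) ∂ν := by
  rw [ext_of_ne _ hx]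
  refine integral_congr_ae (ae_of_all _ fun ξ => ?_)
  simp only [step_Q, ext_of_ne ψ (lin_ne_zero η ξ hx)]

theorem isOpen_punctured : IsOpen ({0}ᶜ : Set (E d)) := isOpen_compl_singleton

theorem uniqueDiffOn_punctured : UniqueDiffOn ℝ ({0}ᶜ : Set (E d)) :=
  isOpen_punctured.uniqueDiffOn

theorem IsCk.continuous {k : ℕ} {ψ : Sph d → ℝ} (h : IsCk k ψ) : Continuous ψ :=
  (h.continuousOn.comp_continuous continuous_subtype_val coe_ne_zero).congr (ext_coe ψ)

/-- The `m`-th derivative of the extension of `ψ`. -/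
abbrev D (m : ℕ) (ψ : Sph d → ℝ) (x : E d) : ContinuousMultilinearMap ℝ (fun _ : Fin m => E d) ℝ :=
  iteratedFDerivWithin ℝ m (ext ψ) {0}ᶜ x

theorem exists_bound_iteratedFDerivWithin {k : ℕ} {h : E d → ℝ} (hh : ContDiffOn ℝ k h {0}ᶜ) :
    ∃ C : ℝ, 0 ≤ C ∧ ∀ j ≤ k, ∀ w : Sph d, ‖iteratedFDerivWithin ℝ j h {0}ᶜ (w : E d)‖ ≤ C := by
  have hj (j : ℕ) (hjk : j ≤ k) :
      ∃ C : ℝ, ∀ w : Sph d, ‖iteratedFDerivWithin ℝ j h {0}ᶜ (w : E d)‖ ≤ C := by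
    have hc : Continuous fun w : Sph d => iteratedFDerivWithin ℝ j h {0}ᶜ (w : E d) :=
      (hh.continuousOn_iteratedFDerivWithin (by exact_mod_cast hjk)
        uniqueDiffOn_punctured).comp_continuous continuous_subtype_val coe_ne_zero
    obtain ⟨C, hC⟩ := (isCompact_range hc).isBounded.exists_norm_le
    exact ⟨C, fun w => hC _ (mem_range_self w)⟩
  choose! C hC using hj
  refine ⟨∑ j ∈ Finset.range (k + 1), |C j|, Finset.sum_nonneg fun _ _ => abs_nonneg _,
    fun j hjk w => (hC j hjk w).trans ((le_abs_self _).trans ?_)⟩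
  exact Finset.single_le_sum (f := fun j => |C j|) (fun _ _ => abs_nonneg _)
    (Finset.mem_range.mpr (by omega))

/-- Since `ext ψ` is invariant under the dilation by `‖x‖⁻¹`, the chain rule makes its `m`-th
derivative homogeneous of degree `-m`. -/
theorem norm_D_le {k m : ℕ} (hmk : m ≤ k) {ψ : Sph d → ℝ} (hψ : IsCk k ψ) {B : ℝ}
    (hB : ∀ w : Sph d, ‖D m ψ (w : E d)‖ ≤ B) {x : E d} (hx : x ≠ 0) :
    ‖D m ψ x‖ ≤ B * ‖x‖⁻¹ ^ m := by
  have hc : 0 < ‖x‖⁻¹ := inv_pos.mpr (norm_pos_iff.mpr hx)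
  set g : E d →L[ℝ] E d := ‖x‖⁻¹ • ContinuousLinearMap.id ℝ (E d) with hg
  have hpre : g ⁻¹' {0}ᶜ = {0}ᶜ := by
    ext y
    simp [hg, hx]
  have hcomp : ext ψ ∘ g = ext ψ := funext fun y => ext_smul ψ hc y
  have := g.iteratedFDerivWithin_comp_right hψ uniqueDiffOn_punctured
    (by rw [hpre]; exact uniqueDiffOn_punctured) (x := x) (smul_ne_zero hc.ne' hx)
    (i := m) (by exact_mod_cast hmk)
  rw [hcomp, hpre] at this
  rw [D, this]
  refine (ContinuousMultilinearMap.norm_compContinuousLinearMap_le _ _).trans ?_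
  have h0 : 0 ≤ B := (norm_nonneg _).trans (hB (Q x hx))
  refine mul_le_mul (hB (Q x hx)) ?_ (Finset.prod_nonneg fun _ _ => norm_nonneg _) h0
  rw [Finset.prod_const, Finset.card_univ, Fintype.card_fin]
  refine pow_le_pow_left₀ (norm_nonneg _) ?_ m
  rw [hg, norm_smul, norm_inv, norm_norm]
  exact mul_le_of_le_one_right hc.le ContinuousLinearMap.norm_id_le

/-! ### The operator on `C^k` -/

theorem contDiffOn_ext_lin {k : ℕ} {ψ : Sph d → ℝ} (hψ : IsCk k ψ) (η : ℝ≥0) (ξ : E d) :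
    ContDiffOn ℝ k (fun y => ext ψ (lin η ξ y)) {0}ᶜ :=
  hψ.comp (lin η ξ).contDiff.contDiffOn fun _ hy => lin_ne_zero η ξ hy

theorem iteratedFDerivWithin_ext_lin {k m : ℕ} (hmk : m ≤ k) {ψ : Sph d → ℝ} (hψ : IsCk k ψ)
    (η : ℝ≥0) (ξ : E d) {x : E d} (hx : x ≠ 0) :
    iteratedFDerivWithin ℝ m (fun y => ext ψ (lin η ξ y)) {0}ᶜ x =
      (D m ψ (lin η ξ x)).compContinuousLinearMap fun _ => lin η ξ := by
  have := (lin η ξ).iteratedFDerivWithin_comp_right hψ uniqueDiffOn_punctured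
    (by rw [lin_preimage]; exact uniqueDiffOn_punctured) (x := x) (lin_ne_zero η ξ hx)
    (i := m) (by exact_mod_cast hmk)
  rwa [lin_preimage] at this

theorem norm_iteratedFDerivWithin_ext_lin_le {k m : ℕ} (hmk : m ≤ k) {ψ : Sph d → ℝ}
    (hψ : IsCk k ψ) {B : ℝ} (hB : ∀ w : Sph d, ‖D m ψ (w : E d)‖ ≤ B) (η : ℝ≥0) {ξ : E d} {R : ℝ}
    (hξ : ‖ξ‖ ≤ R) {x : E d} (hx : x ≠ 0) :
    ‖iteratedFDerivWithin ℝ m (fun y => ext ψ (lin η ξ y)) {0}ᶜ x‖ ≤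
      (1 + η * R ^ 2) ^ m * B * ‖x‖⁻¹ ^ m := by
  rw [iteratedFDerivWithin_ext_lin hmk hψ η ξ hx]
  refine (ContinuousMultilinearMap.norm_compContinuousLinearMap_le _ _).trans ?_
  rw [Finset.prod_const, Finset.card_univ, Fintype.card_fin]
  have h0 : 0 ≤ B := (norm_nonneg _).trans (hB (Q x hx))
  have hx' : 0 < ‖x‖ := norm_pos_iff.mpr hx
  have h1 : ‖D m ψ (lin η ξ x)‖ ≤ B * ‖x‖⁻¹ ^ m := by
    refine (norm_D_le hmk hψ hB (lin_ne_zero η ξ hx)).trans ?_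
    have := norm_le_norm_lin η ξ x
    gcongr
  have h2 : ‖lin η ξ‖ ≤ 1 + η * R ^ 2 := by
    refine (norm_lin_le η ξ).trans ?_
    gcongr
  calc ‖D m ψ (lin η ξ x)‖ * ‖lin η ξ‖ ^ m ≤ (B * ‖x‖⁻¹ ^ m) * (1 + η * R ^ 2) ^ m := by gcongr
    _ = _ := by ring

theorem continuous_iteratedFDerivWithin_ext_lin {k m : ℕ} (hmk : m ≤ k) {ψ : Sph d → ℝ}
    (hψ : IsCk k ψ) (η : ℝ≥0) {x : E d} (hx : x ≠ 0) :
    Continuous fun ξ => iteratedFDerivWithin ℝ m (fun y => ext ψ (lin η ξ y)) {0}ᶜ x := by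
  simp only [iteratedFDerivWithin_ext_lin hmk hψ η _ hx]
  have h1 : Continuous fun ξ => D m ψ (lin η ξ x) :=
    (ContDiffOn.continuousOn_iteratedFDerivWithin hψ (by exact_mod_cast hmk)
      uniqueDiffOn_punctured).comp_continuous ((continuous_lin η).clm_apply continuous_const)
      fun ξ => lin_ne_zero η ξ hx
  have h2 : Continuous fun ξ : E d =>
      ContinuousMultilinearMap.compContinuousLinearMapContinuousMultilinear ℝ
        (fun _ : Fin m => E d) (fun _ => E d) ℝ fun _ => lin η ξ :=
    (ContinuousMultilinearMap.cont _).comp (continuous_pi fun _ => continuous_lin η)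
  exact h2.clm_apply h1

theorem hasFTaylorSeriesUpToOn_op {ν : Measure (E d)} [IsProbabilityMeasure ν] {R : ℝ}
    (hR : ∀ᵐ ξ ∂ν, ‖ξ‖ ≤ R) {k : ℕ} {ψ : Sph d → ℝ} (hψ : IsCk k ψ) (η : ℝ≥0) :
    HasFTaylorSeriesUpToOn k (ext (op ν η ψ))
      (fun x m => ∫ ξ, iteratedFDerivWithin ℝ m (fun y => ext ψ (lin η ξ y)) {0}ᶜ x ∂ν) {0}ᶜ := by
  refine (hasFTaylorSeriesUpToOn_integral isOpen_punctured (contDiffOn_ext_lin hψ η)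
    (fun m hm x hx => (continuous_iteratedFDerivWithin_ext_lin hm hψ η hx).aestronglyMeasurable)
    fun m hm x hx => ?_).congr fun x hx => ext_op ν η ψ hx
  obtain ⟨B, hB0, hB⟩ := exists_bound_iteratedFDerivWithin hψ
  have hx' : 0 < ‖x‖ := norm_pos_iff.mpr hx
  -- The bound blows up at the origin, so the neighbourhood stays at distance `‖x‖ / 2` from it.
  refine ⟨(1 + η * R ^ 2) ^ m * B * (‖x‖ / 2)⁻¹ ^ m, {y | ‖x‖ / 2 < ‖y‖},
    (isOpen_lt continuous_const continuous_norm).mem_nhds (half_lt_self hx'), ?_⟩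
  filter_upwards [hR] with ξ hξ y hy
  have hy' : ‖x‖ / 2 < ‖y‖ := hy
  refine (norm_iteratedFDerivWithin_ext_lin_le hm hψ (hB m hm) η hξ
    (norm_pos_iff.mp ((half_pos hx').trans hy'))).trans ?_
  gcongr

theorem isCk_op {ν : Measure (E d)} [IsProbabilityMeasure ν] {R : ℝ}
    (hR : ∀ᵐ ξ ∂ν, ‖ξ‖ ≤ R) {k : ℕ} {ψ : Sph d → ℝ} (hψ : IsCk k ψ) (η : ℝ≥0) : IsCk k (op ν η ψ) :=
  (hasFTaylorSeriesUpToOn_op hR hψ η).contDiffOn (n := (k : ℕ∞))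

/-- Order `m` is bounded by order `m` alone, with a factor `1 + O(η)` and no additive term; hence
the estimate can be iterated about `T / η` times. -/
theorem norm_D_op_le {ν : Measure (E d)} [IsProbabilityMeasure ν] {R : ℝ}
    (hR : ∀ᵐ ξ ∂ν, ‖ξ‖ ≤ R) {k m : ℕ} (hmk : m ≤ k) {ψ : Sph d → ℝ} (hψ : IsCk k ψ)
    (η : ℝ≥0) {B : ℝ} (hB : ∀ w : Sph d, ‖D m ψ (w : E d)‖ ≤ B) (w : Sph d) :
    ‖D m (op ν η ψ) (w : E d)‖ ≤ (1 + η * R ^ 2) ^ m * B := by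
  rw [D, ← (hasFTaylorSeriesUpToOn_op hR hψ η).eq_iteratedFDerivWithin_of_uniqueDiffOn
    (by exact_mod_cast hmk) uniqueDiffOn_punctured (coe_ne_zero w)]
  refine (norm_integral_le_of_norm_le_const (C := (1 + η * R ^ 2) ^ m * B) ?_).trans (by simp)
  filter_upwards [hR] with ξ hξ
  simpa using norm_iteratedFDerivWithin_ext_lin_le hmk hψ hB η hξ (coe_ne_zero w)

theorem isCk_iterate_op {ν : Measure (E d)} [IsProbabilityMeasure ν] {R : ℝ}
    (hR : ∀ᵐ ξ ∂ν, ‖ξ‖ ≤ R) {k : ℕ} {ψ : Sph d → ℝ} (hψ : IsCk k ψ) (η : ℝ≥0) (n : ℕ) :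
    IsCk k ((op ν η)^[n] ψ) := by
  induction n with
  | zero => exact hψ
  | succ n ih => rw [Function.iterate_succ_apply']; exact isCk_op hR ih η

theorem norm_D_iterate_op_le {ν : Measure (E d)} [IsProbabilityMeasure ν] {R : ℝ}
    (hR : ∀ᵐ ξ ∂ν, ‖ξ‖ ≤ R) {k m : ℕ} (hmk : m ≤ k) {ψ : Sph d → ℝ} (hψ : IsCk k ψ) (η : ℝ≥0)
    {B : ℝ} (hB : ∀ w : Sph d, ‖D m ψ (w : E d)‖ ≤ B) (n : ℕ) (w : Sph d) :
    ‖D m ((op ν η)^[n] ψ) (w : E d)‖ ≤ ((1 + η * R ^ 2) ^ m) ^ n * B := by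
  induction n generalizing w with
  | zero => simpa using hB w
  | succ n ih =>
    rw [Function.iterate_succ_apply', pow_succ', mul_assoc]
    exact norm_D_op_le hR hmk (isCk_iterate_op hR hψ η n) η ih w

/-! ### The mean over the chain -/

theorem continuous_chain (η : ℝ≥0) (n : ℕ) (w : Sph d) :
    Continuous fun ξ : Fin n → E d => chain η n ξ w := by
  induction n with
  | zero => exact continuous_const
  | succ n ih =>
    have h : Continuous fun ξ : Fin (n + 1) → E d => fun i : Fin n => ξ i.castSucc :=
      continuous_pi fun i => continuous_apply i.castSucc
    exact (continuous_step η).comp (g := fun p : Sph d × E d => step η p.2 p.1)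
      (f := fun ξ : Fin (n + 1) → E d => (chain η n (fun i => ξ i.castSucc) w, ξ (Fin.last n)))
      ((ih.comp h).prodMk (continuous_apply (Fin.last n)))

/-- The last sample is independent of the earlier ones and is integrated first, which replaces `φ`
by `op ν η φ`. Continuity of `φ` on the compact sphere gives the integrability for Fubini. -/
theorem mean_succ {ν : Measure (E d)} [IsProbabilityMeasure ν] (η : ℝ≥0)
    {φ : Sph d → ℝ} (hφ : Continuous φ) (n : ℕ) :
    mean ν η φ (n + 1) = mean ν η (op ν η φ) n := by
  funext w
  have hmp := measurePreserving_piFinSuccAbove (fun _ : Fin (n + 1) => ν) (Fin.last n)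
  have hcont : Continuous fun p : E d × (Fin n → E d) => φ (step η p.1 (chain η n p.2 w)) :=
    hφ.comp ((continuous_step η).comp (g := fun p : Sph d × E d => step η p.2 p.1)
      (f := fun p : E d × (Fin n → E d) => (chain η n p.2 w, p.1))
      (((continuous_chain η n w).comp continuous_snd).prodMk continuous_fst))
  obtain ⟨C, hC⟩ := (isCompact_range hφ).isBounded.exists_norm_le
  have hint : Integrable (fun p : E d × (Fin n → E d) => φ (step η p.1 (chain η n p.2 w)))
      (ν.prod (Measure.pi fun _ : Fin n => ν)) :=
    Integrable.of_bound hcont.aestronglyMeasurable C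
      (ae_of_all _ fun p => hC _ (mem_range_self _))
  calc mean ν η φ (n + 1) w
      = ∫ ξ, (fun p : E d × (Fin n → E d) => φ (step η p.1 (chain η n p.2 w)))
          (MeasurableEquiv.piFinSuccAbove (fun _ => E d) (Fin.last n) ξ)
          ∂(Measure.pi fun _ : Fin (n + 1) => ν) := by
        refine integral_congr_ae (ae_of_all _ fun ξ => ?_)
        simp only [chain, MeasurableEquiv.piFinSuccAbove_apply, Fin.insertNthEquiv_last,
          Fin.snocEquiv_symm_apply]
        rfl
    _ = ∫ p, φ (step η p.1 (chain η n p.2 w)) ∂(ν.prod (Measure.pi fun _ : Fin n => ν)) :=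
        hmp.integral_comp' (fun p : E d × (Fin n → E d) => φ (step η p.1 (chain η n p.2 w)))
    _ = mean ν η (op ν η φ) n w := integral_prod_symm _ hint

theorem mean_eq_iterate {ν : Measure (E d)} [IsProbabilityMeasure ν] {R : ℝ}
    (hR : ∀ᵐ ξ ∂ν, ‖ξ‖ ≤ R) (η : ℝ≥0) {φ : Sph d → ℝ} (hφ : IsCk 0 φ) (n : ℕ) :
    mean ν η φ n = (op ν η)^[n] φ := by
  induction n generalizing φ with
  | zero => funext w; simp [mean, chain]
  | succ n ih => rw [mean_succ η hφ.continuous, ih (isCk_op hR hφ η), Function.iterate_succ_apply]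

/-! ### Comparison of spherical and Euclidean derivatives -/

/-- Euler's identity in degree 0. Where `ext ψ` is not differentiable it holds because `fderiv` is
then 0 by convention. -/
theorem fderiv_ext_self (ψ : Sph d → ℝ) (x : E d) : fderiv ℝ (ext ψ) x x = 0 := by
  by_cases h : DifferentiableAt ℝ (ext ψ) x
  · have h1 : HasDerivAt (fun t : ℝ => ext ψ (t • x)) (fderiv ℝ (ext ψ) x x) 1 := by
      have := h.hasFDerivAt.comp_hasDerivAt_of_eq (1 : ℝ) ((hasDerivAt_id (1 : ℝ)).smul_const x)
        (by simp)
      simpa [Function.comp_def] using this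
    have h2 : HasDerivAt (fun t : ℝ => ext ψ (t • x)) 0 1 :=
      (hasDerivAt_const 1 (ext ψ x)).congr_of_eventuallyEq
        ((lt_mem_nhds one_pos).mono fun t ht => ext_smul ψ ht x)
    exact h1.unique h2
  · simp [fderiv_zero_of_not_differentiableAt h]

/-- By Euler's identity the radial part of the direction `e_i - w_i w` contributes nothing; the
factor `‖x‖` compensates for the degree `-1` of the derivative. -/
theorem ext_grad (i : Fin d) (ψ : Sph d → ℝ) {x : E d} (hx : x ≠ 0) :
    ext (grad i ψ) x = ‖x‖ * fderiv ℝ (ext ψ) x (EuclideanSpace.single i 1) := by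
  have hx' : 0 < ‖x‖ := norm_pos_iff.mpr hx
  have h : fderiv ℝ (ext ψ) x = ‖x‖⁻¹ • fderiv ℝ (ext ψ) (‖x‖⁻¹ • x) := by
    rw [← fderiv_comp_smul]
    simp only [ext_smul ψ (inv_pos.mpr hx')]
  rw [ext_of_ne _ hx, grad, map_sub, map_smul, fderiv_ext_self, smul_zero, sub_zero, h,
    smul_apply, smul_eq_mul, mul_inv_cancel_left₀ hx'.ne']
  rfl

theorem contDiffOn_norm_punctured (k : ℕ) : ContDiffOn ℝ k (fun x : E d => ‖x‖) {0}ᶜ :=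
  fun _ hx => (contDiffAt_norm ℝ hx).contDiffWithinAt

theorem contDiffOn_inv_norm_punctured (k : ℕ) : ContDiffOn ℝ k (fun x : E d => ‖x‖⁻¹) {0}ᶜ :=
  (contDiffOn_norm_punctured k).inv fun _ hx => norm_ne_zero_iff.mpr hx

theorem IsCk.contDiffOn_fderiv {k : ℕ} {ψ : Sph d → ℝ} (hψ : IsCk (k + 1) ψ) :
    ContDiffOn ℝ k (fderiv ℝ (ext ψ)) {0}ᶜ :=
  ContDiffOn.fderiv_of_isOpen hψ isOpen_punctured (by simp)

theorem IsCk.of_le {j k : ℕ} {ψ : Sph d → ℝ} (hψ : IsCk k ψ) (h : j ≤ k) : IsCk j ψ :=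
  ContDiffOn.of_le hψ (by exact_mod_cast h)

theorem IsCk.grad {k : ℕ} {ψ : Sph d → ℝ} (hψ : IsCk (k + 1) ψ) (i : Fin d) :
    IsCk k (grad i ψ) :=
  ((contDiffOn_norm_punctured k).mul (hψ.contDiffOn_fderiv.clm_apply contDiffOn_const)).congr
    fun _ hx => ext_grad i ψ hx

/-- Leibniz rule. The constant depends on `h` and `k` only; it is applied with `h` equal to `‖x‖`
and `‖x‖⁻¹`, the factors relating `grad` to partial derivatives. -/
theorem exists_norm_iteratedFDerivWithin_mul_le {k : ℕ} {h : E d → ℝ}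
    (hh : ContDiffOn ℝ k h {0}ᶜ) :
    ∃ C : ℝ, 0 ≤ C ∧ ∀ g : E d → ℝ, ContDiffOn ℝ k g {0}ᶜ → ∀ B : ℝ,
      (∀ j ≤ k, ∀ w : Sph d, ‖iteratedFDerivWithin ℝ j g {0}ᶜ (w : E d)‖ ≤ B) →
      ∀ j ≤ k, ∀ w : Sph d,
        ‖iteratedFDerivWithin ℝ j (fun x => h x * g x) {0}ᶜ (w : E d)‖ ≤ C * B := by
  obtain ⟨c, hc0, hc⟩ := exists_bound_iteratedFDerivWithin hh
  refine ⟨2 ^ k * c, by positivity, fun g hg B hB j hj w => ?_⟩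
  have hB0 : 0 ≤ B := (norm_nonneg _).trans (hB j hj w)
  refine (norm_iteratedFDerivWithin_mul_le hh hg uniqueDiffOn_punctured (coe_ne_zero w)
    (by exact_mod_cast hj)).trans ?_
  calc _ ≤ ∑ i ∈ Finset.range (j + 1), (j.choose i : ℝ) * c * B := by
        refine Finset.sum_le_sum fun i hi => ?_
        have hi' : i ≤ k := by have := Finset.mem_range.mp hi; omega
        exact mul_le_mul (mul_le_mul_of_nonneg_left (hc i hi' w) (by positivity))
          (hB (j - i) (by omega) w) (norm_nonneg _) (by positivity)
    _ = 2 ^ j * c * B := by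
        rw [← Finset.sum_mul, ← Finset.sum_mul]
        congr 2
        exact_mod_cast Nat.sum_range_choose j
    _ ≤ 2 ^ k * c * B := by
        gcongr
        exact one_le_two

theorem exists_norm_D_grad_le (d k : ℕ) :
    ∃ C : ℝ, 0 ≤ C ∧ ∀ ψ : Sph d → ℝ, IsCk (k + 1) ψ → ∀ B : ℝ,
      (∀ j ≤ k + 1, ∀ w : Sph d, ‖D j ψ (w : E d)‖ ≤ B) →
      ∀ i, ∀ j ≤ k, ∀ w : Sph d, ‖D j (grad i ψ) (w : E d)‖ ≤ C * B := by
  obtain ⟨C, hC0, hC⟩ :=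
    exists_norm_iteratedFDerivWithin_mul_le (contDiffOn_norm_punctured (d := d) k)
  refine ⟨C, hC0, fun ψ hψ B hB i j hj w => ?_⟩
  rw [D, iteratedFDerivWithin_congr (s := {0}ᶜ) (fun x hx => ext_grad i ψ hx)
    (coe_ne_zero w)]
  refine hC _ (hψ.contDiffOn_fderiv.clm_apply contDiffOn_const) B (fun l hl v => ?_) j hj w
  refine (norm_iteratedFDerivWithin_clm_apply_const (hψ.contDiffOn_fderiv _ (coe_ne_zero v))
    uniqueDiffOn_punctured (coe_ne_zero v) (by exact_mod_cast hl)).trans ?_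
  rw [PiLp.norm_single, norm_one, one_mul,
    iteratedFDerivWithin_congr (s := {0}ᶜ)
      (fun x hx => (fderivWithin_of_isOpen isOpen_punctured hx).symm) (coe_ne_zero v),
    norm_iteratedFDerivWithin_fderivWithin uniqueDiffOn_punctured (coe_ne_zero v)]
  exact hB _ (by omega) v

theorem eq_sum_smul_proj (L : E d →L[ℝ] ℝ) :
    L = ∑ i, L (EuclideanSpace.single i 1) • (EuclideanSpace.proj i : E d →L[ℝ] ℝ) := by
  ext x
  conv_lhs => rw [← (EuclideanSpace.basisFun (Fin d) ℝ).sum_repr x]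
  simp [mul_comm]

theorem fderivWithin_ext_eq_sum (ψ : Sph d → ℝ) {x : E d} (hx : x ≠ 0) :
    fderivWithin ℝ (ext ψ) {0}ᶜ x =
      ∑ i, (‖x‖⁻¹ * ext (grad i ψ) x) • (EuclideanSpace.proj i : E d →L[ℝ] ℝ) := by
  rw [fderivWithin_of_isOpen isOpen_punctured hx, eq_sum_smul_proj (fderiv ℝ (ext ψ) x)]
  simp only [ext_grad _ ψ hx, inv_mul_cancel_left₀ (norm_ne_zero_iff.mpr hx)]

/-- Inverting `ext_grad` writes the full derivative as a sum of `‖x‖⁻¹ * ext (grad i ψ)` times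
coordinate forms, so `k` derivatives of the gradient control order `k + 1`. -/
theorem exists_norm_D_succ_le (d k : ℕ) :
    ∃ C : ℝ, 0 ≤ C ∧ ∀ ψ : Sph d → ℝ, IsCk (k + 1) ψ → ∀ B : ℝ,
      (∀ i, ∀ j ≤ k, ∀ w : Sph d, ‖D j (grad i ψ) (w : E d)‖ ≤ B) →
      ∀ w : Sph d, ‖D (k + 1) ψ (w : E d)‖ ≤ C * B := by
  obtain ⟨C, hC0, hC⟩ :=
    exists_norm_iteratedFDerivWithin_mul_le (contDiffOn_inv_norm_punctured (d := d) k)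
  refine ⟨∑ i : Fin d, ‖(1 : ℝ →L[ℝ] ℝ).smulRight (EuclideanSpace.proj i : E d →L[ℝ] ℝ)‖ * C,
    Finset.sum_nonneg fun i _ => by positivity, fun ψ hψ B hB w => ?_⟩
  have ha (i : Fin d) : ContDiffOn ℝ k (fun x => ‖x‖⁻¹ * ext (grad i ψ) x) {0}ᶜ :=
    (contDiffOn_inv_norm_punctured k).mul (hψ.grad i)
  have hb (i : Fin d) : ContDiffOn ℝ k (fun x => (‖x‖⁻¹ * ext (grad i ψ) x) •
      (EuclideanSpace.proj i : E d →L[ℝ] ℝ)) {0}ᶜ :=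
    (ha i).smul contDiffOn_const
  rw [D, ← norm_iteratedFDerivWithin_fderivWithin uniqueDiffOn_punctured (coe_ne_zero w),
    iteratedFDerivWithin_congr (s := {0}ᶜ) (fun x hx => fderivWithin_ext_eq_sum ψ hx)
      (coe_ne_zero w),
    iteratedFDerivWithin_fun_sum_apply uniqueDiffOn_punctured (coe_ne_zero w)
      fun i _ => hb i _ (coe_ne_zero w), Finset.sum_mul]
  refine norm_sum_le_of_le _ fun i _ => ?_
  refine (ContinuousLinearMap.norm_iteratedFDerivWithin_comp_left
    ((1 : ℝ →L[ℝ] ℝ).smulRight (EuclideanSpace.proj i : E d →L[ℝ] ℝ)) (ha i _ (coe_ne_zero w))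
    uniqueDiffOn_punctured (coe_ne_zero w) le_rfl).trans ?_
  rw [mul_assoc]
  exact mul_le_mul_of_nonneg_left (hC _ (hψ.grad i) B (hB i) k le_rfl w) (norm_nonneg _)

/-- The definition peels off the outermost derivative. The inductions on `k` need the innermost one,
so that the hypothesis can be applied to `grad i ψ`. -/
theorem iterGrad_succ_last (m : ℕ) (α : Fin (m + 1) → Fin d) (ψ : Sph d → ℝ) :
    iterGrad (m + 1) α ψ =
      iterGrad m (fun j => α j.castSucc) (grad (α (Fin.last m)) ψ) := by
  induction m with
  | zero => rfl
  | succ m ih =>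
    rw [iterGrad, ih]
    rfl

theorem exists_iterGrad_le (d k : ℕ) :
    ∃ C : ℝ, 0 ≤ C ∧ ∀ ψ : Sph d → ℝ, IsCk k ψ → ∀ B : ℝ,
      (∀ j ≤ k, ∀ w : Sph d, ‖D j ψ (w : E d)‖ ≤ B) →
      ∀ j ≤ k, ∀ (α : Fin j → Fin d) (w : Sph d), ‖iterGrad j α ψ w‖ ≤ C * B := by
  have h0 (ψ : Sph d → ℝ) (w : Sph d) : ‖ψ w‖ = ‖D 0 ψ (w : E d)‖ := by
    rw [D, norm_iteratedFDerivWithin_zero, ext_coe]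
  induction k with
  | zero =>
    refine ⟨1, zero_le_one, fun ψ hψ B hB j hj α w => ?_⟩
    obtain rfl : j = 0 := by omega
    rw [one_mul, iterGrad, h0]
    exact hB 0 le_rfl w
  | succ k ih =>
    obtain ⟨C₁, h₁, hC₁⟩ := ih
    obtain ⟨C₂, h₂, hC₂⟩ := exists_norm_D_grad_le d k
    refine ⟨1 + C₁ * C₂, by positivity, fun ψ hψ B hB j hj α w => ?_⟩
    have hB0 : 0 ≤ B := (norm_nonneg _).trans (hB 0 (Nat.zero_le _) w)
    rw [add_mul, one_mul]
    cases j with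
    | zero =>
      rw [iterGrad, h0]
      exact (hB 0 (Nat.zero_le _) w).trans (le_add_of_nonneg_right (by positivity))
    | succ j =>
      rw [iterGrad_succ_last, mul_assoc]
      refine (hC₁ _ (hψ.grad _) (C₂ * B) (hC₂ ψ hψ B hB _) j (by omega) _ w).trans ?_
      exact le_add_of_nonneg_left hB0

theorem exists_norm_D_le (d k : ℕ) :
    ∃ C : ℝ, 0 ≤ C ∧ ∀ ψ : Sph d → ℝ, IsCk k ψ → ∀ B : ℝ,
      (∀ j ≤ k, ∀ (α : Fin j → Fin d) (w : Sph d), ‖iterGrad j α ψ w‖ ≤ B) →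
      ∀ j ≤ k, ∀ w : Sph d, ‖D j ψ (w : E d)‖ ≤ C * B := by
  induction k with
  | zero =>
    refine ⟨1, zero_le_one, fun ψ hψ B hB j hj w => ?_⟩
    obtain rfl : j = 0 := by omega
    rw [one_mul, D, norm_iteratedFDerivWithin_zero, ext_coe]
    exact hB 0 le_rfl Fin.elim0 w
  | succ k ih =>
    obtain ⟨C₁, h₁, hC₁⟩ := ih
    obtain ⟨C₂, h₂, hC₂⟩ := exists_norm_D_succ_le d k
    refine ⟨C₁ + C₂ * C₁, by positivity, fun ψ hψ B hB j hj w => ?_⟩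
    have hB0 : 0 ≤ B := (norm_nonneg _).trans (hB 0 (Nat.zero_le _) Fin.elim0 w)
    rw [add_mul]
    rcases Nat.lt_or_ge k j with h | h
    · obtain rfl : j = k + 1 := by omega
      rw [mul_assoc]
      refine (hC₂ ψ hψ (C₁ * B) (fun i => hC₁ _ (hψ.grad i) B fun l hl α v => ?_) w).trans
        (le_add_of_nonneg_left (by positivity))
      -- Appending `i` at the end makes it the innermost derivative, so `α` acts on `grad i ψ`.
      have := hB (l + 1) (by omega) (Fin.snoc (α := fun _ => Fin d) α i) v
      rw [iterGrad_succ_last] at this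
      simpa using this
    · exact (hC₁ ψ (hψ.of_le k.le_succ) B (fun l hl => hB l (by omega)) j h w).trans
        (le_add_of_nonneg_right (by positivity))

/-! ### Bounds for `ckNorm`, uniform in the number of steps -/

theorem enorm_iterGrad_le_ckNorm {k j : ℕ} (hj : j ≤ k) (α : Fin j → Fin d) (ψ : Sph d → ℝ)
    (w : Sph d) : ‖iterGrad j α ψ w‖ₑ ≤ ckNorm k ψ := by
  refine (le_iSup (fun w => ‖iterGrad j α ψ w‖ₑ) w).trans ?_
  refine (Finset.single_le_sum (f := fun α : Fin j → Fin d => ⨆ w, ‖iterGrad j α ψ w‖ₑ)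
    (fun _ _ => zero_le) (Finset.mem_univ α)).trans ?_
  exact Finset.single_le_sum
    (f := fun m => ∑ α : Fin m → Fin d, ⨆ w, ‖iterGrad m α ψ w‖ₑ)
    (fun _ _ => zero_le) (Finset.mem_range.mpr (Nat.lt_succ_of_le hj))

theorem ckNorm_le {k : ℕ} {ψ : Sph d → ℝ} {B : ℝ≥0∞}
    (h : ∀ j ≤ k, ∀ (α : Fin j → Fin d) (w : Sph d), ‖iterGrad j α ψ w‖ₑ ≤ B) :
    ckNorm k ψ ≤ (∑ m ∈ Finset.range (k + 1), d ^ m : ℕ) * B := by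
  have hm (m : ℕ) (hm : m ∈ Finset.range (k + 1)) :
      ∑ α : Fin m → Fin d, ⨆ w, ‖iterGrad m α ψ w‖ₑ ≤ (d ^ m : ℕ) * B := by
    refine (Finset.sum_le_sum fun α _ => iSup_le
      (h m (Nat.lt_succ_iff.mp (Finset.mem_range.mp hm)) α)).trans_eq ?_
    simp
  refine (Finset.sum_le_sum hm).trans_eq ?_
  rw [← Finset.sum_mul, Nat.cast_sum]

theorem pow_one_add_le_exp {η R T : ℝ} (hη : 0 ≤ η) {n m k : ℕ} (hn : n * η ≤ T) (hmk : m ≤ k) :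
    ((1 + η * R ^ 2) ^ m) ^ n ≤ Real.exp (T * R ^ 2 * k) := by
  have hT : 0 ≤ T := (by positivity : (0 : ℝ) ≤ n * η).trans hn
  have h1 : 1 + η * R ^ 2 ≤ Real.exp (η * R ^ 2) := by
    rw [add_comm]; exact Real.add_one_le_exp _
  calc ((1 + η * R ^ 2) ^ m) ^ n ≤ (Real.exp (η * R ^ 2) ^ m) ^ n := by gcongr
    _ = Real.exp ((n * η) * R ^ 2 * m) := by
        rw [← pow_mul, ← Real.exp_nat_mul]
        push_cast
        ring_nf
    _ ≤ Real.exp (T * R ^ 2 * k) := by gcongr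

theorem exists_ckNorm_iterate_op_le {ν : Measure (E d)} [IsProbabilityMeasure ν] {R : ℝ}
    (hR : ∀ᵐ ξ ∂ν, ‖ξ‖ ≤ R) (k : ℕ) (T : ℝ≥0) :
    ∃ C : ℝ≥0, ∀ φ : Sph d → ℝ, IsCk k φ → ∀ η : ℝ≥0, ∀ n : ℕ, n * η ≤ T →
      ckNorm k ((op ν η)^[n] φ) ≤ C * ckNorm k φ := by
  obtain ⟨C₁, h₁, hC₁⟩ := exists_iterGrad_le d k
  obtain ⟨C₂, h₂, hC₂⟩ := exists_norm_D_le d k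
  -- Read from the right: spherical to Euclidean derivatives, growth over `n` steps, and back to
  -- spherical derivatives.
  set K : ℝ := C₁ * (Real.exp (T * R ^ 2 * k) * C₂) with hK
  have hK0 : 0 ≤ K := by positivity
  -- The sum counts the multi-indices. The `+ 1` keeps the factor nonzero, so that the case `ckNorm
  -- k φ = ⊤` is trivial and finiteness of the norm need not be proved.
  refine ⟨(∑ m ∈ Finset.range (k + 1), d ^ m : ℕ) * (K.toNNReal + 1), fun φ hφ η n hn => ?_⟩
  have hn' : (n : ℝ) * η ≤ T := by exact_mod_cast hn
  rw [ENNReal.coe_mul, ENNReal.coe_natCast, mul_assoc]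
  refine ckNorm_le fun j hj α w => ?_
  by_cases htop : ckNorm k φ = ⊤
  · rw [htop, ENNReal.mul_top (by simp)]
    exact le_top
  set B : ℝ := (ckNorm k φ).toReal with hB
  have hφB : ∀ j ≤ k, ∀ (α : Fin j → Fin d) (w : Sph d), ‖iterGrad j α φ w‖ ≤ B :=
    fun j hj α w => by
      rw [← toReal_enorm]
      exact ENNReal.toReal_mono htop (enorm_iterGrad_le_ckNorm hj α φ w)
  have key : ‖iterGrad j α ((op ν η)^[n] φ) w‖ ≤ K * B := by
    refine (hC₁ _ (isCk_iterate_op hR hφ η n) (Real.exp (T * R ^ 2 * k) * (C₂ * B))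
      (fun l hl v => ?_) j hj α w).trans_eq (by rw [hK]; ring)
    refine (norm_D_iterate_op_le hR hl hφ η (hC₂ φ hφ B hφB l hl) n v).trans ?_
    exact mul_le_mul_of_nonneg_right (pow_one_add_le_exp η.coe_nonneg hn' hl) (by positivity)
  calc ‖iterGrad j α ((op ν η)^[n] φ) w‖ₑ
      ≤ ENNReal.ofReal (K * B) := by
        rw [← ofReal_norm]; exact ENNReal.ofReal_le_ofReal key
    _ = K.toNNReal * ckNorm k φ := by
        rw [ENNReal.ofReal_mul hK0, hB, ENNReal.ofReal_toReal htop]; rfl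
    _ ≤ _ := by
        gcongr
        exact le_self_add

end Oja

end

theorem mainTheorem4 (d : ℕ) (ν : Measure (Oja.E d)) [IsProbabilityMeasure ν]
    (R : ℝ) (hR : ∀ᵐ ξ ∂ν, ‖ξ‖ ≤ R) :
    -- the operator on `L^∞`, and its predual on `L^1`
    (∀ η : ℝ≥0, ∃ S : Lp ℝ ∞ (Oja.surf d) →L[ℝ] Lp ℝ ∞ (Oja.surf d),
      (∀ (u : Oja.Sph d → ℝ) (hu : MemLp u ∞ (Oja.surf d)),
        S (hu.toLp u) =ᵐ[Oja.surf d] Oja.op ν η u) ∧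
      (∀ u, ‖S u‖ ≤ ‖u‖) ∧
      ∃ Sstar : Lp ℝ 1 (Oja.surf d) →L[ℝ] Lp ℝ 1 (Oja.surf d),
        (∀ (u : Lp ℝ ∞ (Oja.surf d)) (ρ : Lp ℝ 1 (Oja.surf d)),
          ∫ w, (S u) w * ρ w ∂(Oja.surf d) = ∫ w, u w * (Sstar ρ) w ∂(Oja.surf d)) ∧
        (∀ ρ, ‖Sstar ρ‖ ≤ ‖ρ‖) ∧
        (∀ ρ, 0 ≤ ρ → 0 ≤ Sstar ρ ∧ ‖Sstar ρ‖ = ‖ρ‖)) ∧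
    -- the bounds in `C^k`
    (∀ k : ℕ, ∃ η₀ : ℝ≥0, 0 < η₀ ∧ ∀ T : ℝ≥0, ∃ C : ℝ≥0,
      ∀ φ : Oja.Sph d → ℝ, Oja.IsCk k φ → ∀ η : ℝ≥0, η ≤ η₀ → ∀ n : ℕ, n * η ≤ T →
        Oja.mean ν η φ n = (Oja.op ν η)^[n] φ ∧
        Oja.IsCk k (Oja.mean ν η φ n) ∧
        Oja.ckNorm k (Oja.mean ν η φ n) ≤ C * Oja.ckNorm k φ) := by
  -- The value 1 for `η₀` is arbitrary: the estimates need no smallness of the step size.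
  refine ⟨Oja.exists_operators ν, fun k => ⟨1, one_pos, fun T => ?_⟩⟩
  obtain ⟨C, hC⟩ := Oja.exists_ckNorm_iterate_op_le hR k T
  refine ⟨C, fun φ hφ η _ n hn => ?_⟩
  have h := Oja.mean_eq_iterate hR η (hφ.of_le (Nat.zero_le k)) n
  rw [h]
  exact ⟨rfl, Oja.isCk_iterate_op hR hφ η n, hC φ hφ η n hn⟩
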